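/- For $p\in\mathbb C$ let $J_p$ be the Bessel function of the first kind, $$J_p(z)=\Big(\frac z2\Big)^p\sum_{k\ge 0}\frac{(-1)^k}{k!\,\Gamma(p+k+1)}\Big(\frac z2\Big)^{2k}$$ (principal branch of the powers, $1/\Gamma=0$ at the poles of $\Gamma$), and let $x^{-p}J_p(x)$ denote the resulting even entire function of $x$, with the value $1/(2^p\,\Gamma(p+1))$ at $x=0$. (1) For every $p\in\mathbb C$, every $r\in\mathbb C\setminus\{0\}$ and all $x\in\mathbb C$, $$x^{-p}J_p(x)=\sum_{k=0}^{\infty}\frac{r^{-(p+k)}J_{p+k}(r)}{2^k\,k!}\,(r^2-x^2)^k ,$$ the series being convergent. (2) Let $p>-2$ be real, let $j_{p+1,1}$ be the first positive zero of $J_{p+1}$, let $0<r\le j_{p+1,1}$ and let $N\ge 0$ be an integer. Put $$R_N(x)=\sum_{k=N+1}^{\infty}\frac{r^{-(p+k)}J_{p+k}(r)}{2^k\,k!}\,(r^2-x^2)^{k-N-1}.$$ This series converges for all real $x$, and $$x^{-p}J_p(x)-\sum_{k=0}^{N}\frac{r^{-(p+k)}J_{p+k}(r)}{2^k\,k!}(r^2-x^2)^k=(r^2-x^2)^{N+1}R_N(x).$$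 If $r<j_{p+1,1}$, all the coefficients $r^{-(p+k)}J_{p+k}(r)/(2^k k!)$ with $k\ge N+1$ are positive. For $|x|\le r$ we have $R_N(r)\le R_N(x)\le R_N(0)$ and $$\sum_{k=0}^{N}\frac{r^{-(p+k)}J_{p+k}(r)}{2^k\,k!}(r^2-x^2)^k+\alpha_p\,(r^2-x^2)^{N+1}\ \le\ x^{-p}J_p(x)\ \le\ \sum_{k=0}^{N}\frac{r^{-(p+k)}J_{p+k}(r)}{2^k\,k!}(r^2-x^2)^k+\beta_p\,(r^2-x^2)^{N+1},$$ where $$\alpha_p=R_N(r)=\frac{r^{-(p+N+1)}J_{p+N+1}(r)}{2^{N+1}(N+1)!},$$ $$\beta_p=R_N(0)=r^{-2(N+1)}\sum_{k=N+1}^{\infty}\frac{r^{k-p}J_{p+k}(r)}{2^k\,k!}=\frac{\dfrac{1}{2^p\,\Gamma(p+1)}-\displaystyle\sum_{k=0}^{N}\frac{r^{k-p}J_{p+k}(r)}{2^k\,k!}}{r^{2(N+1)}} .$$ -/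

import Mathlib

open scoped Nat

/-- The Bessel function of the first kind
`J_ν(z) = (z/2)^ν ∑_k (-1)^k / (k! Γ(ν+k+1)) (z/2)^(2k)`, on the principal branch of `z^ν`.
At a pole of `Γ` Mathlib has `Γ = 0`, so `1 / Γ` is the entire reciprocal Gamma function. -/
noncomputable def besselJ (ν z : ℂ) : ℂ :=
  (z / 2) ^ ν * ∑' k : ℕ, (-1) ^ k / ((k ! : ℂ) * Complex.Gamma (ν + k + 1)) * (z / 2) ^ (2 * k)

/-- The even entire function `z ↦ z^(-ν) J_ν(z)`; its value at `z = 0` is the limit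
`1 / (2^ν Γ(ν+1))`. -/
noncomputable def besselQuot (ν z : ℂ) : ℂ :=
  if z = 0 then 1 / (2 ^ ν * Complex.Gamma (ν + 1)) else z ^ (-ν) * besselJ ν z

/-- `J_ν(x)` as a real number, for real `ν` and `x > 0` (see `ofReal_besselJReal`). -/
noncomputable def besselJReal (ν x : ℝ) : ℝ := (besselJ ν x).re

/-- `x^(-ν) J_ν(x)` as a real number, for real `ν` and any real `x`
(see `ofReal_besselQuotReal`). -/
noncomputable def besselQuotReal (ν x : ℝ) : ℝ := (besselQuot ν x).re

/-- `j_{ν,1}`, the first positive zero of `J_ν` (`⊤` if there were none). -/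
noncomputable def besselFirstZero (ν : ℝ) : EReal :=
  sInf ((fun x : ℝ => (x : EReal)) '' {x : ℝ | 0 < x ∧ besselJReal ν x = 0})

/-- The coefficient `r^(-(p+k)) J_{p+k}(r) / (2^k k!)`, complex version. -/
noncomputable def besselCoeff (p r : ℂ) (k : ℕ) : ℂ :=
  r ^ (-(p + k)) * besselJ (p + k) r / (2 ^ k * (k ! : ℂ))

/-- The coefficient `r^(-(p+k)) J_{p+k}(r) / (2^k k!)`, for real `p` and `r > 0`. -/
noncomputable def besselCoeffReal (p r : ℝ) (k : ℕ) : ℝ :=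
  r ^ (-(p + k)) * besselJReal (p + k) r / (2 ^ k * (k ! : ℝ))

/-- The tail `R_N(x) = ∑_{k ≥ N+1} r^(-(p+k)) J_{p+k}(r) / (2^k k!) (r²-x²)^(k-N-1)`, with the
summation index `m = k - N - 1`. -/
noncomputable def besselTail (p r : ℝ) (N : ℕ) (x : ℝ) : ℝ :=
  ∑' m : ℕ, besselCoeffReal p r (N + 1 + m) * (r ^ 2 - x ^ 2) ^ m

theorem besselQuot_eq_series (ν z : ℂ) :
    besselQuot ν z = 2 ^ (-ν) *
      ∑' k : ℕ, (-1) ^ k / ((k ! : ℂ) * Complex.Gamma (ν + k + 1)) * (z / 2) ^ (2 * k) := by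
  unfold besselQuot besselJ
  split_ifs with h
  · subst h
    rw [tsum_eq_single 0]
    · simp [Complex.cpow_neg, mul_comm]
    · intro k hk
      simp [hk]
  · have h2 : (2 : ℂ) ≠ 0 := two_ne_zero
    have hz : z / 2 ≠ 0 := div_ne_zero h h2
    have hlog : Complex.log z = Complex.log 2 + Complex.log (z / 2) := by
      have := Complex.log_ofReal_mul (r := 2) two_pos hz
      rw [Complex.ofReal_log (by norm_num)] at this
      simpa [mul_div_cancel₀] using this
    rw [← mul_assoc]
    congr 1
    rw [Complex.cpow_def_of_ne_zero h, Complex.cpow_def_of_ne_zero hz,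
      Complex.cpow_def_of_ne_zero h2, ← Complex.exp_add, hlog]
    congr 1
    ring

theorem ofReal_besselSeries (ν x : ℝ) :
    ((∑' k : ℕ, (-1) ^ k / ((k ! : ℝ) * Real.Gamma (ν + k + 1)) * (x / 2) ^ (2 * k) : ℝ) : ℂ) =
      ∑' k : ℕ, (-1) ^ k / ((k ! : ℂ) * Complex.Gamma ((ν : ℂ) + k + 1)) *
        ((x : ℂ) / 2) ^ (2 * k) := by
  rw [Complex.ofReal_tsum]
  refine tsum_congr fun k => ?_
  have : ((ν : ℂ) + k + 1) = ((ν + k + 1 : ℝ) : ℂ) := by push_cast; rfl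
  rw [this, Complex.Gamma_ofReal]
  push_cast
  rfl

theorem ofReal_besselJReal (ν x : ℝ) (hx : 0 < x) :
    ((besselJReal ν x : ℝ) : ℂ) = besselJ ν x := by
  have h : besselJ ν x = (((x / 2) ^ ν * ∑' k : ℕ, (-1) ^ k /
      ((k ! : ℝ) * Real.Gamma (ν + k + 1)) * (x / 2) ^ (2 * k) : ℝ) : ℂ) := by
    rw [Complex.ofReal_mul, ofReal_besselSeries, Complex.ofReal_cpow (by positivity)]
    simp [besselJ]
  rw [besselJReal, h, Complex.ofReal_re]

theorem ofReal_besselQuotReal (ν x : ℝ) :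
    ((besselQuotReal ν x : ℝ) : ℂ) = besselQuot ν x := by
  have h : besselQuot ν x = ((2 ^ (-ν) * ∑' k : ℕ, (-1) ^ k /
      ((k ! : ℝ) * Real.Gamma (ν + k + 1)) * (x / 2) ^ (2 * k) : ℝ) : ℂ) := by
    rw [Complex.ofReal_mul, ofReal_besselSeries, Complex.ofReal_cpow (by positivity),
      besselQuot_eq_series]
    simp
  rw [besselQuotReal, h, Complex.ofReal_re]

/-! Write C_ν for `besselClifford ν`. In the variable w = (x/2)², x^(-p) J_p(x) is 2^(-p) C_p(w),
where C_p is entire and C_p' = -C_{p+1}. The expansion (1) is the Taylor series of C_p at (r/2)²,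
the signs from differentiation turning (x² - r²)^k into (r² - x²)^k.

For (2), the k-th coefficient has the sign of C_{p+k}((r/2)²). As p + 1 > -1, C_{p+1}(0) > 0, so
C_{p+1} stays positive before its first zero. The identity (w^(ν+1) C_{ν+1})' = w^ν C_ν carries
positivity up to all higher orders (`besselCliffordReal_add_one_pos`). Hence R_N is a power series
in r² - x² with nonnegative coefficients, thus monotone in r² - x² ≥ 0, and its extreme values are
at x = r and x = 0. -/

/-- Power series coefficient of the Bessel–Clifford function `besselClifford`. -/
noncomputable def besselCliffordCoeff (ν : ℂ) (k : ℕ) : ℂ :=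
  (-1) ^ k / ((k ! : ℂ) * Complex.Gamma (ν + k + 1))

/-- The entire function `w ↦ ∑ (-1)^k w^k / (k! Γ(ν+k+1))`, so that
`z^(-ν) J_ν(z)` is `2^(-ν)` times its value at `(z/2)^2`. -/
noncomputable def besselClifford (ν w : ℂ) : ℂ := ∑' k : ℕ, besselCliffordCoeff ν k * w ^ k

theorem besselQuot_eq_besselClifford (ν z : ℂ) :
    besselQuot ν z = 2 ^ (-ν) * besselClifford ν ((z / 2) ^ 2) := by
  rw [besselQuot_eq_series]
  simp only [besselClifford, besselCliffordCoeff, pow_mul]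

/-! ### Convergence, derivative and recurrence of C_ν -/

/-- Since 1/Γ(z) = z/Γ(z+1), the norms stop increasing once Re z ≥ 1; the finitely many earlier ones
are bounded by their sum. -/
theorem exists_norm_inv_Gamma_add_nat_le (s : ℂ) :
    ∃ C : ℝ, ∀ k : ℕ, ‖(Complex.Gamma (s + k))⁻¹‖ ≤ C := by
  obtain ⟨m, hm⟩ := exists_nat_ge (1 - s.re)
  have htail : ∀ k : ℕ, ‖(Complex.Gamma (s + (m + k : ℕ)))⁻¹‖ ≤ ‖(Complex.Gamma (s + m))⁻¹‖ := by
    intro k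
    induction k with
    | zero => simp
    | succ k ih =>
      refine le_trans ?_ ih
      rw [Complex.one_div_Gamma_eq_self_mul_one_div_Gamma_add_one (s + (m + k : ℕ)), norm_mul]
      have h1 : 1 ≤ ‖s + ((m + k : ℕ) : ℂ)‖ := by
        refine le_trans ?_ (Complex.re_le_norm _)
        have : (0 : ℝ) ≤ k := k.cast_nonneg
        simp
        linarith
      have h2 : s + ((m + (k + 1) : ℕ) : ℂ) = s + ((m + k : ℕ) : ℂ) + 1 := by push_cast; ring
      rw [h2]
      exact le_mul_of_one_le_left (norm_nonneg _) h1
  refine ⟨∑ k ∈ Finset.range (m + 1), ‖(Complex.Gamma (s + k))⁻¹‖, fun k => ?_⟩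
  have hsingle : ∀ j ∈ Finset.range (m + 1), ‖(Complex.Gamma (s + j))⁻¹‖ ≤
      ∑ k ∈ Finset.range (m + 1), ‖(Complex.Gamma (s + k))⁻¹‖ := fun j hj =>
    Finset.single_le_sum (f := fun k : ℕ => ‖(Complex.Gamma (s + k))⁻¹‖)
      (fun _ _ => norm_nonneg _) hj
  rcases le_total k m with h | h
  · exact hsingle k (by simp; omega)
  · obtain ⟨j, rfl⟩ := Nat.exists_eq_add_of_le h
    exact (htail j).trans (hsingle m (by simp))

theorem exists_norm_besselCliffordCoeff_le (ν : ℂ) :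
    ∃ C : ℝ, ∀ k : ℕ, ‖besselCliffordCoeff ν k‖ ≤ C * (1 / (k ! : ℝ)) := by
  obtain ⟨C, hC⟩ := exists_norm_inv_Gamma_add_nat_le (ν + 1)
  refine ⟨C, fun k => ?_⟩
  have h : besselCliffordCoeff ν k =
      (-1) ^ k * ((Complex.Gamma (ν + 1 + k))⁻¹ * (1 / (k ! : ℂ))) := by
    rw [besselCliffordCoeff, add_right_comm, div_eq_mul_inv, mul_inv, one_div]
    ring
  rw [h]
  simp only [norm_mul, norm_pow, norm_neg, norm_one, one_pow, one_mul, norm_div,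
    Complex.norm_natCast]
  exact mul_le_mul_of_nonneg_right (hC k) (by positivity)

theorem summable_norm_besselCliffordCoeff_mul_pow (ν : ℂ) (R : ℝ) (hR : 0 ≤ R) :
    Summable fun k : ℕ => ‖besselCliffordCoeff ν k‖ * R ^ k := by
  obtain ⟨C, hC⟩ := exists_norm_besselCliffordCoeff_le ν
  refine Summable.of_nonneg_of_le (fun k => by positivity) (fun k => ?_)
    ((Real.summable_pow_div_factorial R).mul_left C)
  calc _ ≤ C * (1 / (k ! : ℝ)) * R ^ k := mul_le_mul_of_nonneg_right (hC k) (by positivity)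
    _ = _ := by ring

theorem hasSum_besselClifford (ν w : ℂ) :
    HasSum (fun k : ℕ => besselCliffordCoeff ν k * w ^ k) (besselClifford ν w) := by
  refine (Summable.of_norm ?_).hasSum
  simpa using summable_norm_besselCliffordCoeff_mul_pow ν ‖w‖ (norm_nonneg w)

theorem succ_mul_besselCliffordCoeff_succ (ν : ℂ) (k : ℕ) :
    (k + 1) * besselCliffordCoeff ν (k + 1) = -besselCliffordCoeff (ν + 1) k := by
  have h : ν + ((k + 1 : ℕ) : ℂ) + 1 = ν + 1 + k + 1 := by push_cast; ring
  have hk : (k + 1 : ℂ) ≠ 0 := Nat.cast_add_one_ne_zero k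
  rw [besselCliffordCoeff, besselCliffordCoeff, h, Nat.factorial_succ, pow_succ]
  push_cast
  rw [div_eq_mul_inv, div_eq_mul_inv, mul_inv, mul_inv, mul_inv]
  field_simp

theorem besselCliffordCoeff_eq_mul (ν : ℂ) (k : ℕ) :
    besselCliffordCoeff ν k = (ν + 1 + k) * besselCliffordCoeff (ν + 1) k := by
  have h := Complex.one_div_Gamma_eq_self_mul_one_div_Gamma_add_one (ν + k + 1)
  rw [besselCliffordCoeff, besselCliffordCoeff, div_eq_mul_inv, div_eq_mul_inv, mul_inv, mul_inv, h,
    show ν + 1 + (k : ℂ) + 1 = ν + k + 1 + 1 by ring]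
  ring

theorem differentiable_besselClifford (ν : ℂ) : Differentiable ℂ (besselClifford ν) := by
  intro w
  have hw : w ∈ Metric.ball (0 : ℂ) (‖w‖ + 1) := by simp
  refine (Complex.differentiableOn_tsum_of_summable_norm
    (F := fun (k : ℕ) w => besselCliffordCoeff ν k * w ^ k)
    (summable_norm_besselCliffordCoeff_mul_pow ν (‖w‖ + 1) (by positivity))
    (fun k => by fun_prop) Metric.isOpen_ball fun k z hz => ?_).differentiableAt
    (Metric.isOpen_ball.mem_nhds hw)
  rw [norm_mul, norm_pow]
  have : ‖z‖ ≤ ‖w‖ + 1 := by simpa using (mem_ball_zero_iff.1 hz).le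
  gcongr

theorem hasDerivAt_besselClifford (ν w : ℂ) :
    HasDerivAt (besselClifford ν) (-besselClifford (ν + 1) w) w := by
  have hw : w ∈ Metric.ball (0 : ℂ) (‖w‖ + 1) := by simp
  have h := Complex.hasSum_deriv_of_summable_norm
    (F := fun (k : ℕ) w => besselCliffordCoeff ν k * w ^ k)
    (summable_norm_besselCliffordCoeff_mul_pow ν (‖w‖ + 1) (by positivity))
    (fun k => by fun_prop) Metric.isOpen_ball (fun k z hz => by
      rw [norm_mul, norm_pow]
      have : ‖z‖ ≤ ‖w‖ + 1 := by simpa using (mem_ball_zero_iff.1 hz).le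
      gcongr) hw
  have h2 : HasSum (fun k : ℕ => deriv (fun w => besselCliffordCoeff ν k * w ^ k) w)
      (-besselClifford (ν + 1) w) := by
    -- The constant term has derivative zero, so dropping it aligns the indices.
    rw [← hasSum_nat_add_iff' 1]
    simp only [Finset.range_one, Finset.sum_singleton, pow_zero, deriv_const, sub_zero]
    refine (hasSum_besselClifford (ν + 1) w).neg.congr_fun ?_
    intro k
    rw [deriv_const_mul_field, deriv_pow_field, Nat.add_sub_cancel, ← neg_mul,
      ← succ_mul_besselCliffordCoeff_succ]
    push_cast
    ring
  rw [h2.unique h]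
  exact (differentiable_besselClifford ν w).hasDerivAt

/-- This is J_ν + J_{ν+2} = (2(ν+1)/z) J_{ν+1}. The factor ν + 1 + k relating the coefficients of
orders ν and ν + 1 splits into ν + 1 and k; the k part is an index shift. -/
theorem besselClifford_eq (ν w : ℂ) :
    besselClifford ν w =
      (ν + 1) * besselClifford (ν + 1) w - w * besselClifford (ν + 1 + 1) w := by
  have h : HasSum (fun k : ℕ => (k : ℂ) * besselCliffordCoeff (ν + 1) k * w ^ k)
      (-(w * besselClifford (ν + 1 + 1) w)) := by
    rw [← hasSum_nat_add_iff' 1]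
    simp only [Finset.range_one, Finset.sum_singleton, Nat.cast_zero, zero_mul, sub_zero]
    refine ((hasSum_besselClifford (ν + 1 + 1) w).mul_left w).neg.congr_fun ?_
    intro k
    push_cast
    rw [succ_mul_besselCliffordCoeff_succ]
    ring
  rw [sub_eq_add_neg]
  refine (hasSum_besselClifford ν w).unique
    ((((hasSum_besselClifford (ν + 1) w).mul_left (ν + 1)).add h).congr_fun fun k => ?_)
  rw [besselCliffordCoeff_eq_mul]
  ring

/-! ### Taylor expansion, part (1) -/

theorem iteratedDeriv_besselClifford (ν : ℂ) (n : ℕ) :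
    iteratedDeriv n (besselClifford ν) = fun w => (-1) ^ n * besselClifford (ν + n) w := by
  induction n with
  | zero => simp
  | succ n ih =>
    rw [iteratedDeriv_succ, ih]
    funext w
    rw [deriv_const_mul_field, (hasDerivAt_besselClifford _ w).deriv]
    push_cast
    rw [pow_succ, add_assoc]
    ring

theorem hasSum_besselClifford_taylor (ν c w : ℂ) :
    HasSum (fun n : ℕ => besselClifford (ν + n) c / (n ! : ℂ) * (c - w) ^ n)
      (besselClifford ν w) := by
  refine (Complex.hasSum_taylorSeries_of_entire (differentiable_besselClifford ν) c w).congr_fun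
    fun n => ?_
  rw [iteratedDeriv_besselClifford, ← neg_sub w c, neg_pow]
  simp only [smul_eq_mul]
  ring

theorem besselCoeff_eq_besselClifford (p r : ℂ) (hr : r ≠ 0) (k : ℕ) :
    besselCoeff p r k =
      2 ^ (-p) * (besselClifford (p + k) ((r / 2) ^ 2) / (k ! : ℂ)) / 4 ^ k := by
  have h := besselQuot_eq_besselClifford (p + k) r
  rw [besselQuot, if_neg hr, neg_add, Complex.cpow_add _ _ two_ne_zero, Complex.cpow_neg 2 (k : ℂ),
    Complex.cpow_natCast, ← neg_add] at h
  rw [besselCoeff, h, show (4 : ℂ) = 2 * 2 by norm_num, mul_pow]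
  field_simp

theorem hasSum_besselQuot (p r : ℂ) (hr : r ≠ 0) (x : ℂ) :
    HasSum (fun k : ℕ => besselCoeff p r k * (r ^ 2 - x ^ 2) ^ k) (besselQuot p x) := by
  rw [besselQuot_eq_besselClifford]
  refine ((hasSum_besselClifford_taylor p ((r / 2) ^ 2) ((x / 2) ^ 2)).mul_left
    (2 ^ (-p))).congr_fun fun k => ?_
  rw [besselCoeff_eq_besselClifford p r hr,
    show (r / 2) ^ 2 - (x / 2) ^ 2 = (r ^ 2 - x ^ 2) / 4 by ring, div_pow _ (4 : ℂ)]
  ring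

/-! ### Positivity for real order and argument -/

theorem ofReal_re_besselClifford (ν w : ℝ) :
    (((besselClifford ν w).re : ℝ) : ℂ) = besselClifford ν w := by
  have h : besselClifford ν w = ((∑' k : ℕ, (-1) ^ k / ((k ! : ℝ) * Real.Gamma (ν + k + 1)) *
      w ^ k : ℝ) : ℂ) := by
    rw [Complex.ofReal_tsum]
    refine tsum_congr fun k => ?_
    rw [besselCliffordCoeff, show ((ν : ℂ) + k + 1) = ((ν + k + 1 : ℝ) : ℂ) by push_cast; rfl,
      Complex.Gamma_ofReal]
    push_cast
    rfl
  rw [h, Complex.ofReal_re]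

/-- The real Bessel–Clifford function. -/
noncomputable def besselCliffordReal (ν w : ℝ) : ℝ := (besselClifford ν w).re

theorem hasDerivAt_besselCliffordReal (ν w : ℝ) :
    HasDerivAt (besselCliffordReal ν) (-besselCliffordReal (ν + 1) w) w := by
  change HasDerivAt (fun x : ℝ => (besselClifford ν x).re) _ _
  simpa [besselCliffordReal] using (hasDerivAt_besselClifford (ν : ℂ) (w : ℂ)).real_of_complex

theorem continuous_besselCliffordReal (ν : ℝ) : Continuous (besselCliffordReal ν) :=
  continuous_iff_continuousAt.2 fun w => (hasDerivAt_besselCliffordReal ν w).continuousAt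

theorem besselCliffordReal_eq (ν w : ℝ) :
    besselCliffordReal ν w =
      (ν + 1) * besselCliffordReal (ν + 1) w - w * besselCliffordReal (ν + 1 + 1) w := by
  apply Complex.ofReal_injective
  have h1 := ofReal_re_besselClifford ν w
  have h2 := ofReal_re_besselClifford (ν + 1) w
  have h3 := ofReal_re_besselClifford (ν + 1 + 1) w
  push_cast [besselCliffordReal] at *
  rw [h1, h2, h3, besselClifford_eq]

theorem besselCliffordReal_zero (ν : ℝ) : besselCliffordReal ν 0 = 1 / Real.Gamma (ν + 1) := by
  apply Complex.ofReal_injective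
  rw [besselCliffordReal, ofReal_re_besselClifford, besselClifford, tsum_eq_single 0]
  · simp [besselCliffordCoeff, ← Complex.Gamma_ofReal]
  · intro k hk
    simp [hk]

theorem besselCliffordReal_zero_pos {ν : ℝ} (hν : -1 < ν) : 0 < besselCliffordReal ν 0 := by
  rw [besselCliffordReal_zero]
  exact one_div_pos.2 (Real.Gamma_pos_of_pos (by linarith))

theorem hasDerivAt_rpow_mul_besselCliffordReal (ν : ℝ) {w : ℝ} (hw : 0 < w) :
    HasDerivAt (fun w => w ^ (ν + 1) * besselCliffordReal (ν + 1) w)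
      (w ^ ν * besselCliffordReal ν w) w := by
  refine ((Real.hasDerivAt_rpow_const (p := ν + 1) (Or.inl hw.ne')).mul
    (hasDerivAt_besselCliffordReal (ν + 1) w)).congr_deriv ?_
  rw [besselCliffordReal_eq ν w, Real.rpow_add_one hw.ne']
  simp
  ring

/-- Raising the order preserves positivity, and gains the right end point. -/
theorem besselCliffordReal_add_one_pos {ν W : ℝ} (hν : -1 < ν)
    (h : ∀ w, 0 ≤ w → w < W → 0 < besselCliffordReal ν w) {w : ℝ} (hw : 0 ≤ w) (hwW : w ≤ W) :
    0 < besselCliffordReal (ν + 1) w := by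
  rcases hw.eq_or_lt with rfl | hw
  · exact besselCliffordReal_zero_pos (by linarith)
  -- The product vanishes at 0 because ν + 1 > 0. Its derivative need only be positive in the
  -- interior, which is why w = W is allowed.
  have hmono : StrictMonoOn (fun w => w ^ (ν + 1) * besselCliffordReal (ν + 1) w)
      (Set.Icc 0 w) := by
    refine strictMonoOn_of_deriv_pos (convex_Icc 0 w) ?_ ?_
    · exact ((Real.continuous_rpow_const (by linarith)).mul
        (continuous_besselCliffordReal _)).continuousOn
    · intro y hy
      rw [interior_Icc] at hy
      rw [(hasDerivAt_rpow_mul_besselCliffordReal ν hy.1).deriv]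
      exact mul_pos (Real.rpow_pos_of_pos hy.1 _) (h y hy.1.le (hy.2.trans_le hwW))
  have h0 := hmono (Set.left_mem_Icc.2 hw.le) (Set.right_mem_Icc.2 hw.le) hw
  simp only [Real.zero_rpow (by linarith : ν + 1 ≠ 0), zero_mul] at h0
  exact pos_of_mul_pos_right h0 (Real.rpow_nonneg hw.le _)

theorem besselCliffordReal_add_nat_pos {ν W : ℝ} (hν : -1 < ν)
    (h : ∀ w, 0 ≤ w → w < W → 0 < besselCliffordReal ν w) (n : ℕ) :
    ∀ w, 0 ≤ w → w ≤ W → 0 < besselCliffordReal (ν + (n + 1 : ℕ)) w := by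
  induction n with
  | zero => simpa using fun w => besselCliffordReal_add_one_pos hν h (w := w)
  | succ n ih =>
    intro w hw hwW
    have := besselCliffordReal_add_one_pos (ν := ν + (n + 1 : ℕ)) (W := W)
      (by push_cast; have : (0 : ℝ) ≤ n := n.cast_nonneg; linarith)
      (fun y hy hyW => ih y hy hyW.le) hw hwW
    rw [add_assoc] at this
    exact_mod_cast this

/-! ### The first zero and the signs of the coefficients -/

theorem besselQuotReal_eq_besselCliffordReal (ν x : ℝ) :
    besselQuotReal ν x = 2 ^ (-ν) * besselCliffordReal ν ((x / 2) ^ 2) := by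
  apply Complex.ofReal_injective
  have h := ofReal_re_besselClifford ν ((x / 2) ^ 2)
  rw [ofReal_besselQuotReal, besselQuot_eq_besselClifford, Complex.ofReal_mul,
    Complex.ofReal_cpow (by norm_num), besselCliffordReal, h]
  push_cast
  rfl

theorem besselQuotReal_of_pos (ν : ℝ) {x : ℝ} (hx : 0 < x) :
    besselQuotReal ν x = x ^ (-ν) * besselJReal ν x := by
  apply Complex.ofReal_injective
  rw [ofReal_besselQuotReal, besselQuot, if_neg (by exact_mod_cast hx.ne'), Complex.ofReal_mul,
    ofReal_besselJReal ν x hx, Complex.ofReal_cpow hx.le]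
  push_cast
  rfl

theorem besselQuotReal_zero (ν : ℝ) :
    besselQuotReal ν 0 = 1 / (2 ^ ν * Real.Gamma (ν + 1)) := by
  rw [besselQuotReal_eq_besselCliffordReal, zero_div, zero_pow two_ne_zero,
    besselCliffordReal_zero, Real.rpow_neg zero_le_two, one_div, one_div, mul_inv]

theorem besselCliffordReal_ne_zero_of_lt_besselFirstZero {ν x : ℝ} (hx : 0 < x)
    (h : (x : EReal) < besselFirstZero ν) : besselCliffordReal ν ((x / 2) ^ 2) ≠ 0 := by
  intro h0
  have hq := besselQuotReal_eq_besselCliffordReal ν x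
  rw [h0, mul_zero, besselQuotReal_of_pos ν hx] at hq
  have hJ : besselJReal ν x = 0 :=
    (mul_eq_zero.1 hq).resolve_left (Real.rpow_pos_of_pos hx _).ne'
  exact h.not_ge (sInf_le ⟨x, ⟨hx, hJ⟩, rfl⟩)

/-- As C_ν(0) > 0, a nonpositive value at w would force a zero y ≤ w, hence a zero 2√y < r of J_ν.
-/
theorem besselCliffordReal_pos_of_lt_besselFirstZero {ν r : ℝ} (hν : -1 < ν) (hr : 0 ≤ r)
    (h : (r : EReal) ≤ besselFirstZero ν) {w : ℝ} (hw : 0 ≤ w) (hwr : w < (r / 2) ^ 2) :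
    0 < besselCliffordReal ν w := by
  by_contra! hneg
  obtain ⟨y, ⟨hy0, hyw⟩, hy⟩ := intermediate_value_Icc' hw
    (continuous_besselCliffordReal ν).continuousOn
    (show (0 : ℝ) ∈ _ from ⟨hneg, (besselCliffordReal_zero_pos hν).le⟩)
  have hypos : 0 < y := by
    refine hy0.lt_of_ne ?_
    rintro rfl
    exact (besselCliffordReal_zero_pos hν).ne' hy
  have hyx : (2 * √y / 2) ^ 2 = y := by
    rw [mul_div_cancel_left₀ _ two_ne_zero, Real.sq_sqrt hy0]
  have hlt : 2 * √y < r := by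
    have : √y < r / 2 := (Real.sqrt_lt' (lt_of_le_of_ne (by positivity) (by
      rintro h; rw [← h] at hwr; norm_num at hwr; linarith))).2 (hyw.trans_lt hwr)
    linarith
  refine besselCliffordReal_ne_zero_of_lt_besselFirstZero (ν := ν) (x := 2 * √y) (by positivity)
    ((EReal.coe_lt_coe_iff.2 hlt).trans_le h) ?_
  rw [hyx, hy]

theorem besselCoeffReal_eq_besselQuotReal (p : ℝ) {r : ℝ} (hr : 0 < r) (k : ℕ) :
    besselCoeffReal p r k = besselQuotReal (p + k) r / (2 ^ k * (k ! : ℝ)) := by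
  rw [besselCoeffReal, besselQuotReal_of_pos _ hr]

theorem besselCoeffReal_pos_iff (p : ℝ) {r : ℝ} (hr : 0 < r) (k : ℕ) :
    0 < besselCoeffReal p r k ↔ 0 < besselCliffordReal (p + k) ((r / 2) ^ 2) := by
  rw [besselCoeffReal_eq_besselQuotReal p hr, besselQuotReal_eq_besselCliffordReal,
    div_pos_iff_of_pos_right (by positivity),
    mul_pos_iff_of_pos_left (Real.rpow_pos_of_pos two_pos _)]

/-- Raising the order above p + 1 gains the right end point, so these coefficients stay positive at
r = j_{p+1,1}; only k = 1 degenerates there. -/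
theorem besselCoeffReal_pos_of_two_le {p r : ℝ} (hp : -2 < p) (hr : 0 < r)
    (h : (r : EReal) ≤ besselFirstZero (p + 1)) {k : ℕ} (hk : 2 ≤ k) :
    0 < besselCoeffReal p r k := by
  rw [besselCoeffReal_pos_iff p hr]
  obtain ⟨n, rfl⟩ := Nat.exists_eq_add_of_le' hk
  have := besselCliffordReal_add_nat_pos (ν := p + 1) (W := (r / 2) ^ 2) (by linarith)
    (fun w hw => besselCliffordReal_pos_of_lt_besselFirstZero (by linarith) hr.le h hw) n
    ((r / 2) ^ 2) (by positivity) le_rfl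
  convert this using 2
  push_cast
  ring

theorem besselCliffordReal_nonneg_of_le_besselFirstZero {ν r : ℝ} (hν : -1 < ν) (hr : 0 < r)
    (h : (r : EReal) ≤ besselFirstZero ν) : 0 ≤ besselCliffordReal ν ((r / 2) ^ 2) := by
  have hW : 0 < (r / 2) ^ 2 := by positivity
  -- The value is a limit from the left of positive values.
  refine ge_of_tendsto ((continuous_besselCliffordReal ν).continuousWithinAt
    (s := Set.Iio ((r / 2) ^ 2))) ?_
  filter_upwards [Ioo_mem_nhdsLT hW] with w hw
  exact (besselCliffordReal_pos_of_lt_besselFirstZero hν hr.le h hw.1.le hw.2).le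

theorem besselCoeffReal_nonneg {p r : ℝ} (hp : -2 < p) (hr : 0 < r)
    (h : (r : EReal) ≤ besselFirstZero (p + 1)) {k : ℕ} (hk : 1 ≤ k) :
    0 ≤ besselCoeffReal p r k := by
  rcases hk.eq_or_lt with rfl | hk
  · rw [besselCoeffReal_eq_besselQuotReal p hr, besselQuotReal_eq_besselCliffordReal, Nat.cast_one]
    have := besselCliffordReal_nonneg_of_le_besselFirstZero (by linarith : -1 < p + 1) hr h
    positivity
  · exact (besselCoeffReal_pos_of_two_le hp hr h hk).le

theorem besselCoeffReal_pos {p r : ℝ} (hp : -2 < p) (hr : 0 < r)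
    (h : (r : EReal) < besselFirstZero (p + 1)) {k : ℕ} (hk : 1 ≤ k) :
    0 < besselCoeffReal p r k := by
  rcases hk.eq_or_lt with rfl | hk
  · rw [besselCoeffReal_pos_iff p hr, Nat.cast_one]
    exact (besselCliffordReal_nonneg_of_le_besselFirstZero (by linarith) hr h.le).lt_of_ne'
      (besselCliffordReal_ne_zero_of_lt_besselFirstZero hr h)
  · exact besselCoeffReal_pos_of_two_le hp hr h.le hk

theorem ofReal_besselCoeffReal (p : ℝ) {r : ℝ} (hr : 0 < r) (k : ℕ) :
    ((besselCoeffReal p r k : ℝ) : ℂ) = besselCoeff p r k := by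
  have h := ofReal_besselJReal (p + k) r hr
  rw [besselCoeffReal, besselCoeff]
  push_cast [Complex.ofReal_cpow hr.le] at *
  rw [h]

theorem hasSum_besselQuotReal (p : ℝ) {r : ℝ} (hr : 0 < r) (x : ℝ) :
    HasSum (fun k : ℕ => besselCoeffReal p r k * (r ^ 2 - x ^ 2) ^ k) (besselQuotReal p x) := by
  rw [← Complex.hasSum_ofReal, ofReal_besselQuotReal]
  refine (hasSum_besselQuot p r (by exact_mod_cast hr.ne') x).congr_fun fun k => ?_
  rw [← ofReal_besselCoeffReal p hr]
  push_cast
  rfl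

/-! ### The tail R_N and its bounds -/

theorem Summable.powerSeries_shift {a : ℕ → ℝ} {t : ℝ} (n : ℕ)
    (h : Summable fun k : ℕ => a k * t ^ k) : Summable fun m : ℕ => a (n + m) * t ^ m := by
  -- Dividing the tail by t^n is impossible at t = 0, i.e. x = ±r, but there only m = 0 contributes.
  rcases eq_or_ne t 0 with rfl | ht
  · refine summable_of_ne_finset_zero (s := {0}) fun m hm => ?_
    rw [zero_pow (by simpa using hm), mul_zero]
  · refine (((summable_nat_add_iff n).2 h).mul_right (t ^ n)⁻¹).congr fun m => ?_
    rw [add_comm m n, pow_add]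
    field_simp

theorem summable_besselTail (p : ℝ) {r : ℝ} (hr : 0 < r) (N : ℕ) (x : ℝ) :
    Summable fun m : ℕ => besselCoeffReal p r (N + 1 + m) * (r ^ 2 - x ^ 2) ^ m :=
  (hasSum_besselQuotReal p hr x).summable.powerSeries_shift (N + 1)

theorem besselQuotReal_sub_sum (p : ℝ) {r : ℝ} (hr : 0 < r) (N : ℕ) (x : ℝ) :
    besselQuotReal p x - ∑ k ∈ Finset.range (N + 1), besselCoeffReal p r k * (r ^ 2 - x ^ 2) ^ k
      = (r ^ 2 - x ^ 2) ^ (N + 1) * besselTail p r N x := by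
  refine ((hasSum_nat_add_iff' (N + 1)).2 (hasSum_besselQuotReal p hr x)).unique ?_
  refine ((summable_besselTail p hr N x).hasSum.mul_left ((r ^ 2 - x ^ 2) ^ (N + 1))).congr_fun
    fun m => ?_
  rw [add_comm m, pow_add]
  ring

theorem besselTail_mono {p r : ℝ} (hp : -2 < p) (hr : 0 < r)
    (h : (r : EReal) ≤ besselFirstZero (p + 1)) (N : ℕ) {x y : ℝ} (hy : y ^ 2 ≤ x ^ 2)
    (hx : x ^ 2 ≤ r ^ 2) : besselTail p r N x ≤ besselTail p r N y := by
  refine (summable_besselTail p hr N x).tsum_le_tsum (fun m => ?_) (summable_besselTail p hr N y)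
  exact mul_le_mul_of_nonneg_left (pow_le_pow_left₀ (by linarith) (by linarith) m)
    (besselCoeffReal_nonneg hp hr h (by omega))

theorem besselTail_self (p r : ℝ) (N : ℕ) :
    besselTail p r N r = besselCoeffReal p r (N + 1) := by
  rw [besselTail, tsum_eq_single 0]
  · simp
  · intro m hm
    rw [sub_self, zero_pow hm, mul_zero]

/-- This converts the terms at x = 0 into those of the two formulas for β_p. -/
theorem besselCoeffReal_mul_sq_pow (p : ℝ) {r : ℝ} (hr : 0 < r) (n : ℕ) :
    besselCoeffReal p r n * (r ^ 2) ^ n =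
      r ^ ((n : ℝ) - p) * besselJReal (p + n) r / (2 ^ n * (n ! : ℝ)) := by
  have h : r ^ ((n : ℝ) - p) = r ^ (-(p + n)) * (r ^ 2) ^ n := by
    rw [← pow_mul, ← Real.rpow_natCast r (2 * n), ← Real.rpow_add hr]
    congr 1
    push_cast
    ring
  rw [h, besselCoeffReal]
  ring

theorem mainTheorem6 :
    (∀ p r : ℂ, r ≠ 0 → ∀ x : ℂ,
      HasSum (fun k : ℕ => besselCoeff p r k * (r ^ 2 - x ^ 2) ^ k) (besselQuot p x)) ∧
    (∀ p r : ℝ, -2 < p → 0 < r → (r : EReal) ≤ besselFirstZero (p + 1) → ∀ N : ℕ,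
      ((r : EReal) < besselFirstZero (p + 1) → ∀ k : ℕ, N + 1 ≤ k → 0 < besselCoeffReal p r k) ∧
      (∀ x : ℝ, Summable (fun m : ℕ => besselCoeffReal p r (N + 1 + m) * (r ^ 2 - x ^ 2) ^ m) ∧
        besselQuotReal p x - ∑ k ∈ Finset.range (N + 1), besselCoeffReal p r k * (r ^ 2 - x ^ 2) ^ k
          = (r ^ 2 - x ^ 2) ^ (N + 1) * besselTail p r N x) ∧
      (∀ x : ℝ, |x| ≤ r →
        besselTail p r N r ≤ besselTail p r N x ∧ besselTail p r N x ≤ besselTail p r N 0 ∧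
        ∑ k ∈ Finset.range (N + 1), besselCoeffReal p r k * (r ^ 2 - x ^ 2) ^ k
            + besselTail p r N r * (r ^ 2 - x ^ 2) ^ (N + 1) ≤ besselQuotReal p x ∧
        besselQuotReal p x ≤
          ∑ k ∈ Finset.range (N + 1), besselCoeffReal p r k * (r ^ 2 - x ^ 2) ^ k
            + besselTail p r N 0 * (r ^ 2 - x ^ 2) ^ (N + 1)) ∧
      besselTail p r N r =
        r ^ (-(p + N + 1)) * besselJReal (p + N + 1) r / (2 ^ (N + 1) * ((N + 1)! : ℝ)) ∧
      HasSum (fun m : ℕ => r ^ (((N + 1 + m : ℕ) : ℝ) - p) *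
          besselJReal (p + (N + 1 + m : ℕ)) r / (2 ^ (N + 1 + m) * ((N + 1 + m)! : ℝ)))
        (r ^ (2 * (N + 1)) * besselTail p r N 0) ∧
      besselTail p r N 0 =
        (1 / (2 ^ p * Real.Gamma (p + 1)) -
          ∑ k ∈ Finset.range (N + 1),
            r ^ ((k : ℝ) - p) * besselJReal (p + k) r / (2 ^ k * (k ! : ℝ)))
          / r ^ (2 * (N + 1))) := by
  refine ⟨hasSum_besselQuot, fun p r hp hr h N => ⟨fun h k hk =>
    besselCoeffReal_pos hp hr h (by omega), fun x => ⟨summable_besselTail p hr N x,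
    besselQuotReal_sub_sum p hr N x⟩, fun x hx => ?_, ?_, ?_, ?_⟩⟩
  · have hx2 : x ^ 2 ≤ r ^ 2 := sq_le_sq' (by linarith [neg_abs_le x]) ((le_abs_self x).trans hx)
    have h1 : besselTail p r N r ≤ besselTail p r N x := besselTail_mono hp hr h N hx2 le_rfl
    have h2 : besselTail p r N x ≤ besselTail p r N 0 :=
      besselTail_mono hp hr h N (by simpa using sq_nonneg x) hx2
    have ht : 0 ≤ (r ^ 2 - x ^ 2) ^ (N + 1) := pow_nonneg (by linarith) _
    have heq := besselQuotReal_sub_sum p hr N x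
    have h3 := mul_le_mul_of_nonneg_left h1 ht
    have h4 := mul_le_mul_of_nonneg_left h2 ht
    exact ⟨h1, h2, by linarith, by linarith⟩
  · rw [besselTail_self, besselCoeffReal]
    push_cast
    simp only [add_assoc]
  · refine ((summable_besselTail p hr N 0).hasSum.mul_left (r ^ (2 * (N + 1)))).congr_fun
      fun m => ?_
    rw [← besselCoeffReal_mul_sq_pow p hr, pow_add, ← pow_mul]
    ring
  · have heq := besselQuotReal_sub_sum p hr N 0
    rw [eq_div_iff (by positivity), ← besselQuotReal_zero]
    simp only [← besselCoeffReal_mul_sq_pow p hr]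
    rw [zero_pow two_ne_zero, sub_zero, ← pow_mul] at heq
    rw [heq, mul_comm]
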